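/- Let $X$ be a real locally convex Hausdorff topological vector space, $T$ a nonempty (typically infinite) index set, and let $f$ and $f_t$ ($t\in T$) be proper, convex, lower semicontinuous functions $X\to\mathbb{R}\cup\{+\infty\}$. Consider the problem $$(\mathrm{P})\qquad \inf f(x)\quad\text{s.t.}\quad f_t(x)\le 0,\ t\in T,$$ with feasible set $E=\{x\in X: f_t(x)\le 0\ \ \forall t\in T\}$. Let $\mathbb{R}_+^{(T)}$ be the set of functions $\lambda:T\to[0,+\infty)$ with finite support; $\sum_{t\in T}\lambda_t f_t$ denotes the sum over the support of $\lambda$ (zero if the support is empty), and $0\times(+\infty)=0$. The Lagrangian-Haar dual of $(\mathrm{P})$ has the value $$\sup(\mathrm{D})=\sup_{\emptyset\ne H\subset T\text{ finite},\ \mu\in\mathbb{R}_+^H}\ \inf_{x\in X}\Big\{f(x)+\sum_{t\in H}\mu_t f_t(x)\Big\}.$$ For a proper convex lower semicontinuous function $h$, the recession function $h_\infty$ is the function whose epigraph is the recession cone of the epigraph of $h$, and $h$ is called weakly inf-locally compact if for every $r\in\mathbb{R}$ the sublevel set $\{x\in X:h(x)\le r\}$ is locally compact in the weak topology of $X$.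 Put $$(\mathrm{P})_\infty=\bigcap_{t\in T}\{x\in X:(f_t)_\infty(x)\le 0\}\cap\{x\in X:f_\infty(x)\le 0\}.$$ Assume that $E\cap\operatorname{dom}f\ne\emptyset$, that there exists $\lambda\in\mathbb{R}_+^{(T)}$ such that $f+\sum_{t\in T}\lambda_t f_t$ is weakly inf-locally compact, and that $(\mathrm{P})_\infty$ is a linear subspace of $X$. Then $(\mathrm{P})$ attains its infimum, and $$\min(\mathrm{P})=\sup(\mathrm{D})=\sup_{\lambda\in\mathbb{R}_+^{(T)}}\ \inf_{x\in X}\Big\{f(x)+\sum_{t\in T}\lambda_t f_t(x)\Big\}\in\mathbb{R}.$$ -/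

import Mathlib

open scoped NNReal

/-- The epigraph of an extended-real-valued function, as a subset of `X × ℝ`. -/
def epi {X : Type*} (h : X → EReal) : Set (X × ℝ) :=
  {p | h p.1 ≤ (p.2 : EReal)}

/-- The effective domain `dom h` of an extended-real-valued function. -/
def effDom {X : Type*} (h : X → EReal) : Set X :=
  {x | h x < ⊤}

/-- The class `Γ(X)` of proper, convex, lower semicontinuous functions `X → ℝ ∪ {±∞}`. -/
structure IsGamma {X : Type*} [AddCommGroup X] [Module ℝ X] [TopologicalSpace X]
    (h : X → EReal) : Prop where
  epi_nonempty : (epi h).Nonempty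
  ne_bot : ∀ x, h x ≠ ⊥
  convex : Convex ℝ (epi h)
  isClosed : IsClosed (epi h)

/-- The recession cone `A_∞` of a (convex) set `A`. -/
def recCone {V : Type*} [AddCommGroup V] [Module ℝ V] (A : Set V) : Set V :=
  {d | ∀ a ∈ A, ∀ s : ℝ, 0 ≤ s → a + s • d ∈ A}

/-- The recession function `h_∞` of `h`: the function whose epigraph is the recession cone
of the epigraph of `h` (see `epi_recFun`). -/
noncomputable def recFun {X : Type*} [AddCommGroup X] [Module ℝ X] (h : X → EReal) :
    X → EReal :=
  fun x => ⨅ (r : ℝ) (_ : (x, r) ∈ recCone (epi h)), (r : EReal)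

/-- For `h` in `Γ(X)`, the recession function satisfies `epi h_∞ = (epi h)_∞`. -/
theorem epi_recFun {X : Type*} [AddCommGroup X] [Module ℝ X] [TopologicalSpace X]
    [IsTopologicalAddGroup X] [ContinuousSMul ℝ X] {h : X → EReal} (hh : IsGamma h) :
    epi (recFun h) = recCone (epi h) := by
  ext ⟨x, r⟩
  constructor
  · intro hx a ha s hs
    have key : ∀ ε : ℝ, 0 < ε → a + s • (x, r + ε) ∈ epi h := by
      intro ε hε
      have h1 : recFun h x < ((r + ε : ℝ) : EReal) :=
        lt_of_le_of_lt hx (by exact_mod_cast lt_add_of_pos_right r hε)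
      simp only [recFun, iInf_lt_iff] at h1
      obtain ⟨q, hq, hqr⟩ := h1
      have hqr' : q < r + ε := by exact_mod_cast hqr
      have h2 := hq a ha s hs
      simp only [epi, Set.mem_ofPred_eq, Prod.fst_add, Prod.smul_fst, Prod.snd_add,
        Prod.smul_snd, smul_eq_mul] at h2 ⊢
      refine h2.trans ?_
      have : a.2 + s * q ≤ a.2 + s * (r + ε) := by
        have := mul_le_mul_of_nonneg_left hqr'.le hs
        linarith
      exact_mod_cast this
    have hcont : Continuous fun ε : ℝ => a + s • (x, r + ε) := by fun_prop
    have hlim : Filter.Tendsto (fun ε : ℝ => a + s • (x, r + ε)) (nhdsWithin 0 (Set.Ioi 0))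
        (nhds (a + s • (x, r))) := by
      have := hcont.tendsto 0
      simp only [add_zero] at this
      exact this.mono_left nhdsWithin_le_nhds
    exact hh.isClosed.mem_of_tendsto hlim
      (Filter.eventually_of_mem self_mem_nhdsWithin fun ε hε => key ε hε)
  · intro hx
    exact iInf₂_le (f := fun (q : ℝ) (_ : (x, q) ∈ recCone (epi h)) => (q : EReal)) r hx

/-- `h` is weakly inf-locally compact: every sublevel set `[h ≤ r]`, `r ∈ ℝ`, is locally compact
for the weak topology of `X`. -/
def WeaklyInfLocallyCompact {X : Type*} [AddCommGroup X] [Module ℝ X] [TopologicalSpace X]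
    [IsTopologicalAddGroup X] [ContinuousSMul ℝ X] (h : X → EReal) : Prop :=
  ∀ r : ℝ, LocallyCompactSpace (toWeakSpace ℝ X '' {x : X | h x ≤ (r : EReal)})

/-- The feasible set `E` of the problem `inf f(x)` subject to `f_t(x) ≤ 0`, `t ∈ T`. -/
def feasibleSet {X T : Type*} (ft : T → X → EReal) : Set X :=
  {x | ∀ t, ft t x ≤ 0}

/-- The recession cone `(P)_∞` of the problem. -/
noncomputable def problemRecCone {X T : Type*} [AddCommGroup X] [Module ℝ X]
    (f : X → EReal) (ft : T → X → EReal) : Set X :=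
  (⋂ t, {x | recFun (ft t) x ≤ 0}) ∩ {x | recFun f x ≤ 0}

/-- The Lagrangian `f(x) + ∑_{t ∈ T} λ_t f_t(x)` for a multiplier `λ ≥ 0` of finite support.
In `EReal`, `0 * ⊤ = 0`. -/
noncomputable def lagrangian {X T : Type*} (f : X → EReal) (ft : T → X → EReal)
    (lam : T →₀ ℝ≥0) (x : X) : EReal :=
  f x + ∑ t ∈ lam.support, ((lam t : ℝ) : EReal) * ft t x

/-- `sup_λ inf_x {f(x) + ∑_{t ∈ T} λ_t f_t(x)}` over the nonnegative `λ` of finite support. -/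
noncomputable def supLagrangeDual {X T : Type*} (f : X → EReal) (ft : T → X → EReal) : EReal :=
  ⨆ lam : T →₀ ℝ≥0, ⨅ x : X, lagrangian f ft lam x

/-- `sup (D)`: the supremum, over the nonempty finite sets `H ⊆ T` and the `μ ∈ ℝ₊^H`, of
`inf_x {f(x) + ∑_{t ∈ H} μ_t f_t(x)}`. -/
noncomputable def supLagrangeHaarDual {X T : Type*} (f : X → EReal) (ft : T → X → EReal) :
    EReal :=
  ⨆ (H : Finset T) (_ : H.Nonempty) (μ : H → ℝ≥0),
    ⨅ x : X, (f x + ∑ t : H, ((μ t : ℝ) : EReal) * ft t x)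

/-!
In the weak topology, a sublevel set of the Lagrangian is locally compact, so around a feasible
point it meets some slab `‖φ x‖ ≤ 1`, with `φ` of finite rank, in a relatively compact set. Moving
along the subspace `(P)_∞` changes none of the functions, so only a complement of `φ((P)_∞)` has to
be controlled there, and compactness of the unit slab makes finitely many constraints enough to
exclude every recession direction. Hence, up to translations by `(P)_∞`, the level set of a finite
relaxed subsystem is weakly compact. This gives a minimizer and, for every `a` below the minimum, a
finite system `f ≤ a`, `f_t ≤ η` with `η > 0` that has no solution.

Since `η > 0`, a feasible point is a Slater point of this finite system, and separation in
`ℝ × ℝ^J` gives multipliers. They may vanish, and because `0 * ⊤ = 0` a vanishing multiplier forgets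
the domain of its constraint. They are therefore averaged with a small proportion of a strictly
positive multiplier, which exists because all the functions involved are bounded below on the
compact set; this costs an arbitrarily small part of the value.
-/

section RecessionDirections

variable {Y ι : Type*} [AddCommGroup Y] [Module ℝ Y] [TopologicalSpace Y] {S : ι → Set Y}

theorem exists_finset_forall_smul_notMem [ContinuousConstSMul ℝ Y]
    (hclosed : ∀ i, IsClosed (S i)) (hstar : ∀ i, StarConvex ℝ 0 (S i)) {P : Set Y}
    (hP : IsCompact P) (hleave : ∀ d ∈ P, ∃ i, ∃ s : ℝ, 0 ≤ s ∧ s • d ∉ S i) :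
    ∃ (H : Finset ι) (R : ℝ), 1 ≤ R ∧ ∀ d ∈ P, ∃ i ∈ H, R • d ∉ S i := by
  classical
  let U : Finset ι × Set.Ici (1 : ℝ) → Set Y := fun j => {d | ∃ i ∈ j.1, (j.2 : ℝ) • d ∉ S i}
  have hUopen : ∀ j, IsOpen (U j) := fun j => by
    have : U j = ⋃ i ∈ j.1, {d | (j.2 : ℝ) • d ∈ S i}ᶜ := by ext; simp [U]
    rw [this]
    exact isOpen_biUnion fun i _ =>
      ((hclosed i).preimage (continuous_const_smul (j.2 : ℝ))).isOpen_compl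
  have smul_notMem_of_le : ∀ (i : ι) (d : Y) (s R : ℝ), 0 ≤ s → s ≤ R → 0 < R → s • d ∉ S i →
      R • d ∉ S i := fun i d s R hs hsR hR hout hin => hout <| by
    have := (hstar i).smul_mem hin (div_nonneg hs hR.le) ((div_le_one hR).2 hsR)
    rwa [smul_smul, div_mul_cancel₀ _ hR.ne'] at this
  have hUmono : Monotone U := fun j j' hj d ⟨i, hi, hd⟩ =>
    ⟨i, hj.1 hi, smul_notMem_of_le i d _ _ (zero_le_one.trans j.2.2) hj.2
      (zero_lt_one.trans_le j'.2.2) hd⟩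
  have hcover : P ⊆ ⋃ j, U j := fun d hd => by
    obtain ⟨i, s, hs, hout⟩ := hleave d hd
    exact Set.mem_iUnion.2 ⟨({i}, ⟨max s 1, Set.mem_Ici.2 (le_max_right s 1)⟩), i,
      Finset.mem_singleton_self i,
      smul_notMem_of_le i d s _ hs (le_max_left _ _) (by positivity) hout⟩
  obtain ⟨⟨H, R⟩, hHR⟩ := hP.elim_directed_cover U hUopen hcover hUmono.directed_le
  exact ⟨H, R, R.2, hHR⟩

theorem exists_isCompact_of_slab [ContinuousConstSMul ℝ Y] {E : Type*} [NormedAddCommGroup E]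
    [NormedSpace ℝ E] (hclosed : ∀ i, IsClosed (S i)) (hstar : ∀ i, StarConvex ℝ 0 (S i))
    {F : Finset ι} {K : Set Y} (hK : IsCompact K) {φ : Y →L[ℝ] E}
    (hslab : ∀ x, (∀ i ∈ F, x ∈ S i) → ‖φ x‖ ≤ 1 → x ∈ K) {M : Submodule ℝ Y}
    (hM : IsClosed (M : Set Y))
    (hray : ∀ d ∈ M, (∀ i, ∀ s : ℝ, 0 ≤ s → s • d ∈ S i) → φ d = 0) :
    ∃ (H : Finset ι) (Q : Set Y), IsCompact Q ∧ ∀ x ∈ M, (∀ i ∈ H, x ∈ S i) → x ∈ Q := by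
  classical
  let P : Set Y := {d | (∀ i ∈ F, d ∈ S i) ∧ d ∈ M ∧ ‖φ d‖ = 1}
  have hP : IsCompact P := by
    refine hK.of_isClosed_subset ?_ fun d hd => hslab d hd.1 hd.2.2.le
    have : P = (⋂ i ∈ F, S i) ∩ (M ∩ {d | ‖φ d‖ = 1}) := by ext; simp [P]
    rw [this]
    exact (isClosed_biInter fun i _ => hclosed i).inter
      (hM.inter (isClosed_eq φ.continuous.norm continuous_const))
  have hleave : ∀ d ∈ P, ∃ i, ∃ s : ℝ, 0 ≤ s ∧ s • d ∉ S i := fun d hd => by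
    by_contra! hin
    simpa [hray d hd.2.1 hin] using hd.2.2
  obtain ⟨H, R, hR, hout⟩ := exists_finset_forall_smul_notMem hclosed hstar hP hleave
  have hR0 : 0 < R := by positivity
  refine ⟨H ∪ F, (R • ·) '' K, hK.image (continuous_const_smul R), fun x hxM hx => ?_⟩
  have hxH : ∀ i ∈ H, x ∈ S i := fun i hi => hx i (Finset.mem_union_left _ hi)
  have hxF : ∀ i ∈ F, x ∈ S i := fun i hi => hx i (Finset.mem_union_right _ hi)
  have hnorm : ‖φ x‖ ≤ R := by
    by_contra! hlt
    have hr0 : 0 < ‖φ x‖ := hR0.trans hlt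
    obtain ⟨i, hi, hnot⟩ := hout (‖φ x‖⁻¹ • x)
      ⟨fun i hi => (hstar i).smul_mem (hxF i hi) (by positivity)
        (inv_le_one_of_one_le₀ (hR.trans hlt.le)), M.smul_mem _ hxM,
        by rw [map_smul, norm_smul, norm_inv, norm_norm, inv_mul_cancel₀ hr0.ne']⟩
    refine hnot ?_
    rw [smul_smul]
    exact (hstar i).smul_mem (hxH i hi) (by positivity) (mul_inv_le_one_of_le₀ hlt.le hr0.le)
  refine ⟨R⁻¹ • x, hslab _ (fun i hi => ?_) ?_, smul_inv_smul₀ hR0.ne' x⟩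
  · exact (hstar i).smul_mem (hxF i hi) (by positivity) (inv_le_one_of_one_le₀ hR)
  · rwa [map_smul, norm_smul, Real.norm_of_nonneg (by positivity), inv_mul_le_one₀ hR0]

theorem exists_isClosed_submodule_add_mem {E : Type*} [NormedAddCommGroup E]
    [NormedSpace ℝ E] [FiniteDimensional ℝ E] (φ : Y →L[ℝ] E) (L : Submodule ℝ Y) :
    ∃ M : Submodule ℝ Y, IsClosed (M : Set Y) ∧ (∀ x, ∃ l ∈ L, x + l ∈ M) ∧
      ∀ d ∈ L, d ∈ M → φ d = 0 := by
  obtain ⟨W, hW⟩ := (L.map (φ : Y →ₗ[ℝ] E)).exists_isCompl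
  refine ⟨W.comap (φ : Y →ₗ[ℝ] E), W.closed_of_finiteDimensional.preimage φ.continuous,
    fun x => ?_, fun d hdL hdM => ?_⟩
  · obtain ⟨u, hu, w, hw, huw⟩ := Submodule.mem_sup.1
      (hW.sup_eq_top ▸ Submodule.mem_top : φ x ∈ L.map (φ : Y →ₗ[ℝ] E) ⊔ W)
    obtain ⟨l, hl, rfl⟩ := hu
    refine ⟨-l, L.neg_mem hl, ?_⟩
    have : φ (x + -l) = w := by simp [← huw]
    simpa [this] using hw
  · exact Submodule.disjoint_def.1 hW.disjoint _ (Submodule.mem_map_of_mem hdL) hdM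

theorem exists_isCompact_forall_exists_add_mem [ContinuousConstSMul ℝ Y] {E : Type*}
    [NormedAddCommGroup E] [NormedSpace ℝ E] [FiniteDimensional ℝ E]
    (hclosed : ∀ i, IsClosed (S i)) (hstar : ∀ i, StarConvex ℝ 0 (S i))
    {F : Finset ι} {K : Set Y} (hK : IsCompact K) {φ : Y →L[ℝ] E}
    (hslab : ∀ x, (∀ i ∈ F, x ∈ S i) → ‖φ x‖ ≤ 1 → x ∈ K) {L : Submodule ℝ Y}
    (hadd : ∀ i, ∀ x ∈ S i, ∀ l ∈ L, x + l ∈ S i)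
    (hray : ∀ d, (∀ i, ∀ s : ℝ, 0 ≤ s → s • d ∈ S i) → d ∈ L) :
    ∃ (H : Finset ι) (Q : Set Y), IsCompact Q ∧
      ∀ x, (∀ i ∈ H, x ∈ S i) → ∃ l ∈ L, x + l ∈ Q := by
  obtain ⟨M, hMclosed, hLM, hker⟩ := exists_isClosed_submodule_add_mem φ L
  obtain ⟨H, Q, hQ, hHQ⟩ := exists_isCompact_of_slab hclosed hstar hK hslab hMclosed
    fun d hd hdS => hker d (hray d hdS) hd
  refine ⟨H, Q, hQ, fun x hx => ?_⟩
  obtain ⟨l, hl, hxl⟩ := hLM x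
  exact ⟨l, hl, hHQ _ hxl fun i hi => hadd i x (hx i hi) l hl⟩

end RecessionDirections

section WeakTopology

variable {X : Type*} [AddCommGroup X] [Module ℝ X] [TopologicalSpace X]

theorem exists_finiteRank_slab_subset {U : Set (WeakSpace ℝ X)} (hU : U ∈ nhds 0) :
    ∃ (s : Finset (StrongDual ℝ X)) (φ : WeakSpace ℝ X →L[ℝ] (s → ℝ)),
      ∀ y, ‖φ y‖ ≤ 1 → y ∈ U := by
  obtain ⟨V, hV, hVU⟩ := (topDualPairing ℝ X).flip.hasBasis_weakBilin.mem_iff.1 hU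
  obtain ⟨s, r, hr, rfl⟩ := (SeminormFamily.basisSets_iff _).1 hV
  let ψ : StrongDual ℝ X → (WeakSpace ℝ X →L[ℝ] ℝ) := fun f =>
    { toLinearMap := (f : X →ₗ[ℝ] ℝ) ∘ₗ (toWeakSpace ℝ X).symm.toLinearMap
      cont := WeakBilin.eval_continuous (topDualPairing ℝ X).flip f }
  refine ⟨s, (2 / r) • ContinuousLinearMap.pi fun f : s => ψ f, fun y hy => hVU ?_⟩
  refine (Seminorm.mem_ball_zero _).2 (Seminorm.finset_sup_apply_lt hr fun f hf => ?_)
  have hcoord : ‖(2 / r) * ψ f y‖ ≤ 1 := (norm_le_pi_norm _ (⟨f, hf⟩ : s)).trans hy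
  have hlt : ‖ψ f y‖ < r := by
    rw [norm_mul, Real.norm_of_nonneg (by positivity), div_mul_eq_mul_div, div_le_one hr] at hcoord
    linarith [norm_nonneg (ψ f y)]
  exact hlt

theorem exists_isCompact_slab_of_locallyCompactSpace {C : Set (WeakSpace ℝ X)}
    [LocallyCompactSpace C] {y₀ : WeakSpace ℝ X} (hy₀ : y₀ ∈ C) :
    ∃ (s : Finset (StrongDual ℝ X)) (φ : WeakSpace ℝ X →L[ℝ] (s → ℝ))
      (K : Set (WeakSpace ℝ X)), IsCompact K ∧ ∀ y, y₀ + y ∈ C → ‖φ y‖ ≤ 1 → y ∈ K := by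
  obtain ⟨N, hN, hNy₀⟩ := exists_compact_mem_nhds (⟨y₀, hy₀⟩ : C)
  obtain ⟨U, hU, hUN⟩ := mem_nhds_subtype _ _ _ |>.1 hNy₀
  obtain ⟨s, φ, hφ⟩ := exists_finiteRank_slab_subset (U := (y₀ + ·) ⁻¹' U)
    ((continuous_const_add y₀).tendsto' 0 y₀ (add_zero y₀) hU)
  refine ⟨s, φ, (-y₀ + ·) '' (Subtype.val '' N),
    (hN.image continuous_subtype_val).image (continuous_const_add _), fun y hy hy1 => ?_⟩
  exact ⟨y₀ + y, ⟨⟨y₀ + y, hy⟩, hUN (hφ y hy1), rfl⟩, neg_add_cancel_left y₀ y⟩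

end WeakTopology

section Gamma

variable {X : Type*} [AddCommGroup X] [Module ℝ X] [TopologicalSpace X] {h : X → EReal}

theorem IsGamma.convex_sublevel (hh : IsGamma h) (a : ℝ) : Convex ℝ {x | h x ≤ a} := by
  intro x hx y hy s t hs ht hst
  have := hh.convex (x := (x, a)) hx (y := (y, a)) hy hs ht hst
  simpa [epi, ← add_mul, hst] using this

theorem IsGamma.isClosed_sublevel (hh : IsGamma h) (a : ℝ) : IsClosed {x | h x ≤ a} :=
  hh.isClosed.preimage (f := fun x : X => (x, a)) (by fun_prop)

theorem lowerSemicontinuous_of_isClosed_real_sublevel {Y : Type*} [TopologicalSpace Y]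
    {h : Y → EReal} (hbot : ∀ y, h y ≠ ⊥) (hclosed : ∀ a : ℝ, IsClosed {y | h y ≤ a}) :
    LowerSemicontinuous h := by
  rw [lowerSemicontinuous_iff_isClosed_preimage]
  intro a
  induction a with
  | bot =>
    convert isClosed_empty
    ext y
    simpa using hbot y
  | coe a => exact hclosed a
  | top => simp

theorem IsGamma.lowerSemicontinuous (hh : IsGamma h) : LowerSemicontinuous h :=
  lowerSemicontinuous_of_isClosed_real_sublevel hh.ne_bot hh.isClosed_sublevel

variable [IsTopologicalAddGroup X] [ContinuousSMul ℝ X]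

theorem IsGamma.isClosed_weakSpace_sublevel [LocallyConvexSpace ℝ X] (hh : IsGamma h) (a : ℝ) :
    IsClosed {y : WeakSpace ℝ X | h ((toWeakSpace ℝ X).symm y) ≤ a} := by
  have himage : {y : WeakSpace ℝ X | h ((toWeakSpace ℝ X).symm y) ≤ a} =
      toWeakSpace ℝ X '' closure {x | h x ≤ a} := by
    rw [(hh.isClosed_sublevel a).closure_eq, LinearEquiv.image_eq_preimage_symm]
    rfl
  rw [himage, (hh.convex_sublevel a).toWeakSpace_closure ℝ]
  exact isClosed_closure

theorem IsGamma.comp_toWeakSpace_symm [LocallyConvexSpace ℝ X] (hh : IsGamma h) :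
    IsGamma (h ∘ (toWeakSpace ℝ X).symm) where
  epi_nonempty := hh.epi_nonempty.imp fun _ hp => hp
  ne_bot _ := hh.ne_bot _
  convex := hh.convex.linear_preimage
    ((toWeakSpace ℝ X).symm.toLinearMap.prodMap (LinearMap.id : ℝ →ₗ[ℝ] ℝ))
  isClosed := (lowerSemicontinuous_of_isClosed_real_sublevel (fun _ => hh.ne_bot _)
    hh.isClosed_weakSpace_sublevel).isClosed_epigraph.preimage
      (continuous_id.prodMap continuous_coe_real_ereal)

theorem IsGamma.recFun_nonpos_iff (hh : IsGamma h) {d : X} :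
    recFun h d ≤ 0 ↔ (d, (0 : ℝ)) ∈ recCone (epi h) := by
  rw [← epi_recFun hh]
  simp [epi]

theorem IsGamma.le_of_recFun_nonpos (hh : IsGamma h) {d : X} (hd : recFun h d ≤ 0) (x : X) :
    h (x + d) ≤ h x := by
  induction hx : h x with
  | bot => exact (hh.ne_bot x hx).elim
  | coe a => simpa [epi] using hh.recFun_nonpos_iff.1 hd (x, a) hx.le 1 zero_le_one
  | top => exact le_top

theorem IsGamma.recFun_nonpos_of_ray (hh : IsGamma h) {x₀ d : X} {c : ℝ}
    (hray : ∀ s : ℝ, 0 ≤ s → h (x₀ + s • d) ≤ c) : recFun h d ≤ 0 := by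
  rw [hh.recFun_nonpos_iff]
  rintro ⟨x, r⟩ hx s hs
  let γ : ℝ → X × ℝ := fun e => ((1 - e) • x + e • x₀ + s • d, (1 - e) * r + e * c)
  have hγ : ∀ e, 0 < e → e < 1 → γ e ∈ epi h := fun e he he1 => by
    have hmem : (1 - e) • (x, r) + e • (x₀ + (s / e) • d, c) ∈ epi h :=
      hh.convex hx (hray (s / e) (by positivity)) (by linarith) he.le (by ring)
    convert hmem using 1
    ext <;> simp [γ, smul_smul, mul_div_cancel₀ _ he.ne', add_assoc]
  have hlim : Filter.Tendsto γ (nhdsWithin 0 (Set.Ioi 0)) (nhds ((x, r) + s • (d, (0 : ℝ)))) := by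
    have hcont : Continuous γ := by fun_prop
    simpa [γ] using (hcont.tendsto 0).mono_left nhdsWithin_le_nhds
  refine hh.isClosed.mem_of_tendsto hlim ?_
  filter_upwards [Ioo_mem_nhdsGT (zero_lt_one (α := ℝ))] with e he
  exact hγ e he.1 he.2

theorem exists_isCompact_forall_exists_le [LocallyConvexSpace ℝ X] {ι : Type*}
    {g : ι → X → EReal} (hg : ∀ i, IsGamma (g i)) {c : ι → ℝ} {x₀ : X} (hx₀ : ∀ i, g i x₀ ≤ c i)
    {L : Submodule ℝ X} (hL : ∀ d, d ∈ L ↔ ∀ i, recFun (g i) d ≤ 0) {F : Finset ι} {C : Set X}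
    [LocallyCompactSpace (toWeakSpace ℝ X '' C)] (hC : ∀ x, (∀ i ∈ F, g i x ≤ c i) → x ∈ C) :
    ∃ (H : Finset ι) (Q : Set (WeakSpace ℝ X)), IsCompact Q ∧ ∀ x, (∀ i ∈ H, g i x ≤ c i) →
      ∃ q ∈ Q, ∀ i, g i ((toWeakSpace ℝ X).symm q) ≤ g i x := by
  let k := toWeakSpace ℝ X
  let S : ι → Set (WeakSpace ℝ X) := fun i => {y | g i (k.symm (k x₀ + y)) ≤ c i}
  have hadd : ∀ i y, ∀ l ∈ L.comap k.symm.toLinearMap, g i (k.symm (y + l)) ≤ g i (k.symm y) :=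
    fun i y l hl => by
      rw [map_add]
      exact (hg i).le_of_recFun_nonpos ((hL _).1 hl i) _
  obtain ⟨s, φ, K, hK, hφ⟩ := exists_isCompact_slab_of_locallyCompactSpace
    (Set.mem_image_of_mem k (hC x₀ fun i _ => hx₀ i))
  obtain ⟨H, Q, hQ, hHQ⟩ := exists_isCompact_forall_exists_add_mem (S := S)
    (fun i => ((hg i).isClosed_weakSpace_sublevel (c i)).preimage (continuous_const_add (k x₀)))
    (fun i => Convex.starConvex (((hg i).comp_toWeakSpace_symm.convex_sublevel
      (c i)).translate_preimage_right (k x₀)) (by simpa [S] using hx₀ i))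
    hK (fun y hy => hφ y ⟨_, hC _ hy, k.apply_symm_apply _⟩)
    (fun i y hy l hl => by
      change g i (k.symm (k x₀ + (y + l))) ≤ c i
      rw [← add_assoc]
      exact (hadd i _ l hl).trans hy)
    (fun d hd => (hL (k.symm d)).2 fun i => (hg i).recFun_nonpos_of_ray (x₀ := x₀) (c := c i)
      fun s hs => by simpa [S] using hd i s hs)
  refine ⟨H, (k x₀ + ·) '' Q, hQ.image (continuous_const_add _), fun x hx => ?_⟩
  obtain ⟨l, hl, hlQ⟩ := hHQ (k x - k x₀) fun i hi => by simpa [S] using hx i hi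
  refine ⟨_, Set.mem_image_of_mem _ hlQ, fun i => ?_⟩
  rw [← add_assoc, add_sub_cancel]
  simpa [k] using hadd i (k x) l hl

end Gamma

theorem coe_finsetSum {κ : Type*} (s : Finset κ) (b : κ → ℝ) :
    ((∑ t ∈ s, b t : ℝ) : EReal) = ∑ t ∈ s, (b t : EReal) :=
  map_sum (⟨⟨Real.toEReal, EReal.coe_zero⟩, EReal.coe_add⟩ : ℝ →+ EReal) b s

section Multipliers

theorem exists_separating_dual_lt_interior {V : Type*} [AddCommGroup V] [Module ℝ V]
    [TopologicalSpace V] [IsTopologicalAddGroup V] [ContinuousSMul ℝ V] {A B : Set V}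
    (hA : Convex ℝ A) (hB : Convex ℝ B) (hint : (interior B).Nonempty) (hdisj : Disjoint A B) :
    ∃ (Φ : V →L[ℝ] ℝ) (u : ℝ), (∀ z ∈ interior B, Φ z < u) ∧ (∀ z ∈ B, Φ z ≤ u) ∧
      ∀ z ∈ A, u ≤ Φ z := by
  obtain ⟨Φ, u, hlt, hA⟩ := geometric_hahn_banach_open hB.interior isOpen_interior hA
    (hdisj.symm.mono_left interior_subset)
  have hsub : closure (interior B) ⊆ {z | Φ z ≤ u} :=
    closure_minimal (fun z hz => (hlt z hz).le) (isClosed_le Φ.continuous continuous_const)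
  rw [hB.closure_interior_eq_closure_of_nonempty_interior hint] at hsub
  exact ⟨Φ, u, hlt, fun z hz => hsub (subset_closure hz), hA⟩

theorem map_nonneg_of_forall_map_le {E : Type*} [AddCommGroup E] [PartialOrder E]
    [IsOrderedAddMonoid E] [Module ℝ E] [PosSMulMono ℝ E] {φ : E →ₗ[ℝ] ℝ} {c : E} {u : ℝ}
    (h : ∀ v ≤ c, φ v ≤ u) {v : E} (hv : 0 ≤ v) : 0 ≤ φ v := by
  by_contra! hneg
  obtain ⟨n, hn⟩ := exists_nat_gt ((u - φ c) / -φ v)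
  rw [div_lt_iff₀ (neg_pos.2 hneg)] at hn
  have hle := h (c - (n : ℝ) • v) (sub_le_self c (smul_nonneg n.cast_nonneg hv))
  rw [map_sub, map_smul, smul_eq_mul] at hle
  linarith

theorem map_prod_eq_fst_mul_add {E : Type*} [AddCommGroup E] [Module ℝ E]
    (Φ : ℝ × E →ₗ[ℝ] ℝ) (z : ℝ × E) : Φ z = z.1 * Φ (1, 0) + Φ (0, z.2) := by
  rw [← smul_eq_mul, ← map_smul, ← map_add]
  simp

variable {E : Type*} [AddCommGroup E] [PartialOrder E] [IsOrderedAddMonoid E] [Module ℝ E]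
  [PosSMulMono ℝ E] [TopologicalSpace E] [IsTopologicalAddGroup E] [ContinuousSMul ℝ E]
  {A : Set (ℝ × E)}

theorem exists_multiplier_of_disjoint_Iic (hA : Convex ℝ A) {a : ℝ} {c : E}
    (hdisj : Disjoint A (Set.Iic (a, c))) {z₀ : ℝ × E} (hz₀ : z₀ ∈ A)
    (hslater : Set.Iic c ∈ nhds z₀.2) :
    ∃ φ : E →L[ℝ] ℝ, (∀ v, 0 ≤ v → 0 ≤ φ v) ∧ ∀ z ∈ A, a + φ c ≤ z.1 + φ z.2 := by
  obtain ⟨m, hma, hmz₀⟩ : ∃ m, m < a ∧ m < z₀.1 :=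
    ⟨min a z₀.1 - 1, by grind, by grind⟩
  have hint : (m, z₀.2) ∈ interior (Set.Iic (a, c)) := by
    rw [mem_interior_iff_mem_nhds, Set.Iic_prod_eq]
    exact prod_mem_nhds (Iic_mem_nhds hma) hslater
  obtain ⟨Φ, u, hlt, hBu, hAu⟩ :=
    exists_separating_dual_lt_interior hA (convex_Iic _) ⟨_, hint⟩ hdisj
  let τ : ℝ := Φ (1, 0)
  let ψ : E →L[ℝ] ℝ := Φ.comp (ContinuousLinearMap.inr ℝ ℝ E)
  have hΦ : ∀ z : ℝ × E, Φ z = z.1 * τ + ψ z.2 := map_prod_eq_fst_mul_add Φ.toLinearMap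
  have hτ : 0 < τ := by
    have hstrict := (hlt _ hint).trans_le (hAu z₀ hz₀)
    rw [hΦ, hΦ, add_lt_add_iff_right] at hstrict
    exact pos_of_mul_pos_right (by linarith : 0 < (z₀.1 - m) * τ) (sub_pos.2 hmz₀).le
  have hψ : ∀ v ≤ c, ψ.toLinearMap v ≤ u - a * τ := fun v hv => by
    have := hBu (a, v) ⟨le_rfl, hv⟩
    rw [hΦ] at this
    exact le_sub_iff_add_le'.2 this
  refine ⟨τ⁻¹ • ψ,
    fun v hv => mul_nonneg (inv_nonneg.2 hτ.le) (map_nonneg_of_forall_map_le hψ hv),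
    fun z hz => ?_⟩
  have hle := mul_le_mul_of_nonneg_left ((hBu (a, c) Set.self_mem_Iic).trans (hAu z hz))
    (inv_nonneg.2 hτ.le)
  simpa [hΦ, mul_add, mul_comm _ τ, inv_mul_cancel_left₀ hτ.ne'] using hle

theorem exists_multiplier_ge_smul (hA : Convex ℝ A) {b : ℝ × E} {ψ : E →L[ℝ] ℝ} {N : ℝ}
    (hN : ∀ z ∈ A, z ≤ b → N ≤ z.1 + ψ z.2) {z₀ : ℝ × E} (hz₀ : z₀ ∈ A)
    (hslater : Set.Iic b ∈ nhds z₀) :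
    ∃ (φ : E →L[ℝ] ℝ) (δ D : ℝ), 0 < δ ∧ (∀ v, 0 ≤ v → δ * ψ v ≤ φ v) ∧
      ∀ z ∈ A, D ≤ z.1 + φ z.2 := by
  -- `z.1 + ψ z.2` becomes the objective and `z.1` one more constraint, with multiplier `σ`;
  -- dividing by `1 + σ` restores the coefficient `1` of `z.1`.
  let ℓ : ℝ × E →ₗ[ℝ] ℝ × (ℝ × E) :=
    (LinearMap.fst ℝ ℝ E + (ψ : E →ₗ[ℝ] ℝ) ∘ₗ LinearMap.snd ℝ ℝ E).prod LinearMap.id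
  have hdisj : Disjoint (ℓ '' A) (Set.Iic (N - 1, b)) := by
    rw [Set.disjoint_left]
    rintro _ ⟨z, hz, rfl⟩ ⟨h1, h2⟩
    have hle : z.1 + ψ z.2 ≤ N - 1 := h1
    linarith [hN z hz h2]
  obtain ⟨χ, hχ, hle⟩ := exists_multiplier_of_disjoint_Iic (hA.linear_image ℓ) hdisj
    (Set.mem_image_of_mem ℓ hz₀) hslater
  let σ : ℝ := χ (1, 0)
  have hσ : 0 < 1 + σ := by
    have : 0 ≤ σ := hχ _ ⟨zero_le_one, le_rfl⟩
    positivity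
  let χ₂ : E →L[ℝ] ℝ := χ.comp (ContinuousLinearMap.inr ℝ ℝ E)
  have hχ₂ : ∀ z : ℝ × E, χ z = z.1 * σ + χ₂ z.2 := map_prod_eq_fst_mul_add χ.toLinearMap
  refine ⟨(1 + σ)⁻¹ • (ψ + χ₂), (1 + σ)⁻¹, (1 + σ)⁻¹ * (N - 1 + χ b), inv_pos.2 hσ,
    fun v hv => mul_le_mul_of_nonneg_left ?_ (inv_nonneg.2 hσ.le), fun z hz => ?_⟩
  · exact le_add_of_nonneg_right (hχ (0, v) ⟨le_rfl, hv⟩)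
  · have hz' : N - 1 + χ b ≤ z.1 + ψ z.2 + χ z := hle _ (Set.mem_image_of_mem ℓ hz)
    rw [hχ₂ z] at hz'
    calc (1 + σ)⁻¹ * (N - 1 + χ b)
        ≤ (1 + σ)⁻¹ * ((1 + σ) * z.1 + (ψ + χ₂) z.2) := by
          refine mul_le_mul_of_nonneg_left (hz'.trans_eq ?_) (inv_nonneg.2 hσ.le)
          simp only [add_apply]
          ring
      _ = z.1 + ((1 + σ)⁻¹ • (ψ + χ₂)) z.2 := by
          rw [mul_add, inv_mul_cancel_left₀ hσ.ne']
          rfl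

theorem exists_multiplier_ge_smul_of_disjoint_Iic (hA : Convex ℝ A) {α a b : ℝ} (hα : α < a)
    {c : E} (hc : 0 ≤ c) (hdisj : Disjoint A (Set.Iic (a, c))) {ψ : E →L[ℝ] ℝ} {N : ℝ}
    (hN : ∀ z ∈ A, z ≤ (b, c) → N ≤ z.1 + ψ z.2) {z₀ : ℝ × E} (hz₀ : z₀ ∈ A)
    (hslater : Set.Iic (b, c) ∈ nhds z₀) :
    ∃ (φ : E →L[ℝ] ℝ) (δ : ℝ), 0 < δ ∧ (∀ v, 0 ≤ v → δ * ψ v ≤ φ v) ∧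
      ∀ z ∈ A, α ≤ z.1 + φ z.2 := by
  have hslater₂ : Set.Iic c ∈ nhds z₀.2 := by
    rw [Set.Iic_prod_eq, ← Prod.mk.eta (p := z₀), prod_mem_nhds_iff] at hslater
    exact hslater.2
  obtain ⟨φ₁, hφ₁, hA₁⟩ := exists_multiplier_of_disjoint_Iic hA hdisj hz₀ hslater₂
  obtain ⟨φ₂, δ, D, hδ, hφ₂, hA₂⟩ := exists_multiplier_ge_smul hA hN hz₀ hslater
  obtain ⟨e, he, he1, heα⟩ : ∃ e : ℝ, 0 < e ∧ e ≤ 1 ∧ α ≤ (1 - e) * a + e * D := by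
    obtain ⟨e, he, hlt⟩ := exists_pos_mul_lt (sub_pos.2 hα) |a - D|
    refine ⟨min e 1, by positivity, min_le_right _ _, ?_⟩
    have h1 : min e 1 * (a - D) ≤ min e 1 * |a - D| := by gcongr; exact le_abs_self _
    have h2 : min e 1 * |a - D| ≤ e * |a - D| := by gcongr; exact min_le_left _ _
    linarith
  have he1' : 0 ≤ 1 - e := sub_nonneg.2 he1
  refine ⟨(1 - e) • φ₁ + e • φ₂, e * δ, by positivity, fun v hv => ?_, fun z hz => ?_⟩
  · have h1 := mul_nonneg he1' (hφ₁ v hv)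
    have h2 := mul_le_mul_of_nonneg_left (hφ₂ v hv) he.le
    simp only [add_apply, smul_apply, smul_eq_mul]
    linarith
  · have h1 := mul_le_mul_of_nonneg_left
      ((le_add_of_nonneg_right (hφ₁ c hc)).trans (hA₁ z hz)) he1'
    have h2 := mul_le_mul_of_nonneg_left (hA₂ z hz) he.le
    simp only [add_apply, smul_apply, smul_eq_mul]
    linarith

end Multipliers

section ConvexSystem

variable {X κ : Type*} {f : X → EReal} {g : κ → X → EReal}

/-- The set of pairs `(s, v)` such that the system `f ≤ s`, `g_t ≤ v_t` is solvable, i.e. the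
epigraph of the perturbation function of the problem (up to attainment). -/
def perturbationSet (f : X → EReal) (g : κ → X → EReal) : Set (ℝ × (κ → ℝ)) :=
  {z | ∃ x, f x ≤ z.1 ∧ ∀ t, g t x ≤ z.2 t}

theorem convex_perturbationSet [AddCommGroup X] [Module ℝ X] (hf : Convex ℝ (epi f))
    (hg : ∀ t, Convex ℝ (epi (g t))) : Convex ℝ (perturbationSet f g) := by
  rintro z ⟨x, hfx, hgx⟩ w ⟨y, hfy, hgy⟩ s r hs hr hsr
  exact ⟨s • x + r • y, hf (x := (x, z.1)) hfx (y := (y, w.1)) hfy hs hr hsr,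
    fun t => hg t (x := (x, z.2 t)) (hgx t) (y := (y, w.2 t)) (hgy t) hs hr hsr⟩

theorem exists_mem_perturbationSet_Iic_mem_nhds [Finite κ] {x₀ : X} {b η : ℝ} (hf : f x₀ < b)
    (hg : ∀ t, g t x₀ < η) :
    ∃ z ∈ perturbationSet f g, Set.Iic (b, fun _ => η) ∈ nhds z := by
  obtain ⟨s, hfs, hsb⟩ := EReal.lt_iff_exists_real_btwn.1 hf
  choose v hgv hvη using fun t => EReal.lt_iff_exists_real_btwn.1 (hg t)
  refine ⟨(s, v), ⟨x₀, hfs.le, fun t => (hgv t).le⟩, ?_⟩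
  rw [Set.Iic_prod_eq]
  exact prod_mem_nhds (Iic_mem_nhds (EReal.coe_lt_coe_iff.1 hsb))
    (pi_Iic_mem_nhds fun t => EReal.coe_lt_coe_iff.1 (hvη t))

theorem coe_le_add_sum_mul_of_forall_real [Fintype κ] {a : EReal} {b : κ → EReal} {μ : κ → ℝ}
    {α : ℝ} (ha : a ≠ ⊥) (hb : ∀ t, b t ≠ ⊥) (hμ : ∀ t, 0 < μ t)
    (h : ∀ (p : ℝ) (q : κ → ℝ), a = p → (∀ t, b t = q t) → α ≤ p + ∑ t, μ t * q t) :
    (α : EReal) ≤ a + ∑ t, (μ t : EReal) * b t := by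
  classical
  have hterm : ∀ t, (μ t : EReal) * b t ≠ ⊥ := fun t => by
    simp [EReal.mul_eq_bot, hb, (hμ t).not_gt]
  have hsum : ∀ s : Finset κ, ∑ t ∈ s, (μ t : EReal) * b t ≠ ⊥ := fun s =>
    Finset.sum_induction _ (· ≠ ⊥) (fun _ _ hx hy => EReal.add_ne_bot_iff.2 ⟨hx, hy⟩)
      EReal.zero_ne_bot fun t _ => hterm t
  by_cases hatop : a = ⊤
  · rw [hatop, EReal.top_add_of_ne_bot (hsum _)]
    exact le_top
  by_cases hbtop : ∃ t, b t = ⊤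
  · obtain ⟨t, ht⟩ := hbtop
    rw [← Finset.add_sum_erase _ _ (Finset.mem_univ t), ht, EReal.coe_mul_top_of_pos (hμ t),
      EReal.top_add_of_ne_bot (hsum _), EReal.add_top_of_ne_bot ha]
    exact le_top
  push Not at hbtop
  lift a to ℝ using ⟨hatop, ha⟩
  lift b to κ → ℝ using fun t => ⟨hbtop t, hb t⟩
  have hα := h a b rfl fun _ => rfl
  rw [← EReal.coe_le_coe_iff, EReal.coe_add, coe_finsetSum] at hα
  simpa only [EReal.coe_mul] using hα

theorem exists_pos_multipliers [AddCommGroup X] [Module ℝ X] [Fintype κ]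
    (hf : Convex ℝ (epi f)) (hg : ∀ t, Convex ℝ (epi (g t))) (hfbot : ∀ x, f x ≠ ⊥)
    (hgbot : ∀ t x, g t x ≠ ⊥) {x₀ : X} {α a b η : ℝ} (hα : α < a) (hη : 0 ≤ η) (hfx₀ : f x₀ < b)
    (hgx₀ : ∀ t, g t x₀ < η) (hno : ∀ x, f x ≤ a → ¬ ∀ t, g t x ≤ η) {N : ℝ} {M : κ → ℝ}
    (hbdd : ∀ x, f x ≤ b → (∀ t, g t x ≤ η) → N ≤ f x ∧ ∀ t, M t ≤ g t x) :
    ∃ μ : κ → ℝ, (∀ t, 0 < μ t) ∧ ∀ x, (α : EReal) ≤ f x + ∑ t, (μ t : EReal) * g t x := by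
  classical
  let ψ : (κ → ℝ) →L[ℝ] ℝ := ∑ t, ContinuousLinearMap.proj t
  have hψ : ∀ v, ψ v = ∑ t, v t := fun v => by simp [ψ]
  obtain ⟨z₀, hz₀, hslater⟩ := exists_mem_perturbationSet_Iic_mem_nhds hfx₀ hgx₀
  have hdisj : Disjoint (perturbationSet f g) (Set.Iic (a, fun _ => η)) :=
    Set.disjoint_left.2 fun z ⟨x, hfx, hgx⟩ hz => hno x
      (hfx.trans (by exact_mod_cast hz.1)) fun t => (hgx t).trans (by exact_mod_cast hz.2 t)
  have hN : ∀ z ∈ perturbationSet f g, z ≤ (b, fun _ => η) → N + ∑ t, M t ≤ z.1 + ψ z.2 := by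
    rintro z ⟨x, hfx, hgx⟩ hz
    obtain ⟨hNx, hMx⟩ := hbdd x (hfx.trans (by exact_mod_cast hz.1))
      fun t => (hgx t).trans (by exact_mod_cast hz.2 t)
    rw [hψ]
    exact add_le_add (EReal.coe_le_coe_iff.1 (hNx.trans hfx))
      (Finset.sum_le_sum fun t _ => EReal.coe_le_coe_iff.1 ((hMx t).trans (hgx t)))
  obtain ⟨φ, δ, hδ, hφψ, hφ⟩ := exists_multiplier_ge_smul_of_disjoint_Iic
    (convex_perturbationSet hf hg) hα (fun _ => hη) hdisj hN hz₀ hslater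
  let e : κ → κ → ℝ := fun t j => if t = j then 1 else 0
  have hpos : ∀ t, 0 < φ (e t) := fun t => hδ.trans_le <| by
    simpa [hψ, e] using hφψ (e t) fun j => by simp only [e]; split_ifs <;> simp
  refine ⟨fun t => φ (e t), hpos, fun x => coe_le_add_sum_mul_of_forall_real (hfbot x)
    (fun t => hgbot t x) hpos fun p q hp hq => ?_⟩
  have hpq := hφ (p, q) ⟨x, hp.le, fun t => (hq t).le⟩
  have hsum : φ q = ∑ t, q t * φ (e t) := LinearMap.pi_apply_eq_sum_univ φ.toLinearMap q
  simpa only [hsum, mul_comm] using hpq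

end ConvexSystem

section Problem

variable {X T : Type*} {f : X → EReal} {ft : T → X → EReal} {lam : T →₀ ℝ≥0}

/-- The level set `f ≤ a` of the relaxation of the problem in which only the constraints `t ∈ K`
are kept, in the weakened form `f_t ≤ ε`. -/
def relaxedSublevel (f : X → EReal) (ft : T → X → EReal) (K : Finset T) (a ε : ℝ) : Set X :=
  {x | f x ≤ a ∧ ∀ t ∈ K, ft t x ≤ ε}

/-- Every point of `C` is improved, for the objective and for all the constraint functions at
once, by a point of `Q`. -/
def DominatedBy (f : X → EReal) (ft : T → X → EReal) (C Q : Set X) : Prop :=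
  ∀ x ∈ C, ∃ q ∈ Q, f q ≤ f x ∧ ∀ t, ft t q ≤ ft t x

theorem relaxedSublevel_mono {K J : Finset T} (hKJ : K ⊆ J) {a c η ε : ℝ} (hac : a ≤ c)
    (hηε : η ≤ ε) : relaxedSublevel f ft J a η ⊆ relaxedSublevel f ft K c ε := fun _ hx =>
  ⟨hx.1.trans (by exact_mod_cast hac), fun t ht => (hx.2 t (hKJ ht)).trans (by exact_mod_cast hηε)⟩

theorem mem_relaxedSublevel_of_mem_feasibleSet {x : X} (hx : x ∈ feasibleSet ft) {a : ℝ}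
    (ha : f x ≤ a) (K : Finset T) {ε : ℝ} (hε : 0 ≤ ε) : x ∈ relaxedSublevel f ft K a ε :=
  ⟨ha, fun t _ => (hx t).trans (by exact_mod_cast hε)⟩

theorem lagrangian_le_of_mem_relaxedSublevel {a ε : ℝ} {x : X}
    (hx : x ∈ relaxedSublevel f ft lam.support a ε) :
    lagrangian f ft lam x ≤ ((a + (∑ t ∈ lam.support, (lam t : ℝ)) * ε : ℝ) : EReal) := by
  rw [EReal.coe_add, Finset.sum_mul, coe_finsetSum]
  refine add_le_add hx.1 (Finset.sum_le_sum fun t ht => ?_)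
  rw [EReal.coe_mul]
  exact mul_le_mul_of_nonneg_left (hx.2 t ht) (by exact_mod_cast (lam t).2)

theorem lagrangian_le_of_mem_feasibleSet {x : X} (hx : x ∈ feasibleSet ft) :
    lagrangian f ft lam x ≤ f x := by
  have hsum : ∑ t ∈ lam.support, ((lam t : ℝ) : EReal) * ft t x ≤ 0 :=
    Finset.sum_nonpos fun t _ => by
      have hlam : (0 : EReal) ≤ ((lam t : ℝ) : EReal) := by exact_mod_cast (lam t).2
      simpa using mul_le_mul_of_nonneg_left (hx t) hlam
  simpa [lagrangian] using add_le_add_right hsum (f x)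

theorem mem_problemRecCone_iff [AddCommGroup X] [Module ℝ X] {d : X} :
    d ∈ problemRecCone f ft ↔ ∀ i : Option T, recFun (i.elim f ft) d ≤ 0 := by
  simp [problemRecCone, Option.forall, and_comm]

theorem exists_isCompact_dominatedBy [AddCommGroup X] [Module ℝ X] [TopologicalSpace X]
    [IsTopologicalAddGroup X] [ContinuousSMul ℝ X] [LocallyConvexSpace ℝ X] (hf : IsGamma f)
    (hft : ∀ t, IsGamma (ft t)) {r : ℝ}
    [LocallyCompactSpace (toWeakSpace ℝ X '' {x | lagrangian f ft lam x ≤ r})]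
    {L : Submodule ℝ X} (hL : (L : Set X) = problemRecCone f ft) {x₀ : X}
    (hx₀ : x₀ ∈ feasibleSet ft) (hr : f x₀ < r) :
    ∃ (K : Finset T) (c ε : ℝ) (Q : Set (WeakSpace ℝ X)), f x₀ < c ∧ 0 < ε ∧ IsCompact Q ∧
      DominatedBy (f ∘ (toWeakSpace ℝ X).symm) (fun t => ft t ∘ (toWeakSpace ℝ X).symm)
        (relaxedSublevel (f ∘ (toWeakSpace ℝ X).symm) (fun t => ft t ∘ (toWeakSpace ℝ X).symm)
          K c ε) Q := by
  obtain ⟨c, hc, hcr⟩ := EReal.lt_iff_exists_real_btwn.1 hr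
  rw [EReal.coe_lt_coe_iff] at hcr
  obtain ⟨ε, hε, hεr⟩ : ∃ ε : ℝ, 0 < ε ∧ c + (∑ t ∈ lam.support, (lam t : ℝ)) * ε ≤ r := by
    obtain ⟨ε, hε, h⟩ := exists_pos_mul_lt (sub_pos.2 hcr) (∑ t ∈ lam.support, (lam t : ℝ))
    exact ⟨ε, hε, by linarith⟩
  obtain ⟨H, Q, hQ, hHQ⟩ := exists_isCompact_forall_exists_le (g := fun i => i.elim f ft)
    (c := fun i => i.elim c fun _ => ε) (x₀ := x₀) (F := Finset.insertNone lam.support)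
    (C := {x | lagrangian f ft lam x ≤ r}) (Option.forall.2 ⟨hf, hft⟩)
    (Option.forall.2 ⟨hc.le, fun t => (hx₀ t).trans (by exact_mod_cast hε.le)⟩)
    (fun d => by rw [← SetLike.mem_coe, hL, mem_problemRecCone_iff])
    (fun x hx => (lagrangian_le_of_mem_relaxedSublevel (a := c) (ε := ε) ⟨by simpa using hx none,
      fun t ht => hx (some t) (Finset.some_mem_insertNone.2 ht)⟩).trans (by exact_mod_cast hεr))
  refine ⟨H.eraseNone, c, ε, Q, hc, hε, hQ, fun y hy => ?_⟩
  obtain ⟨q, hq, hqy⟩ := hHQ ((toWeakSpace ℝ X).symm y) (Option.forall.2 ⟨fun _ => hy.1,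
    fun t ht => hy.2 t (Finset.mem_eraseNone.2 ht)⟩)
  exact ⟨q, hq, hqy none, fun t => hqy (some t)⟩

section Compactness

variable [TopologicalSpace X] {K : Finset T} {c ε : ℝ} {Q : Set X}

theorem isClosed_feasibleSet (hft : ∀ t, LowerSemicontinuous (ft t)) :
    IsClosed (feasibleSet ft) := by
  have : feasibleSet ft = ⋂ t, ft t ⁻¹' Set.Iic 0 := by ext; simp [feasibleSet]
  rw [this]
  exact isClosed_iInter fun t => (hft t).isClosed_preimage 0

theorem isClosed_relaxedSublevel (hf : LowerSemicontinuous f)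
    (hft : ∀ t, LowerSemicontinuous (ft t)) (J : Finset T) (a η : ℝ) :
    IsClosed (relaxedSublevel f ft J a η) := by
  have : relaxedSublevel f ft J a η = f ⁻¹' Set.Iic a ∩ ⋂ t ∈ J, ft t ⁻¹' Set.Iic η := by
    ext; simp [relaxedSublevel]
  rw [this]
  exact (hf.isClosed_preimage a).inter
    (isClosed_biInter fun t _ => (hft t).isClosed_preimage η)

theorem exists_isMinOn_feasibleSet (hf : LowerSemicontinuous f)
    (hft : ∀ t, LowerSemicontinuous (ft t)) (hε : 0 ≤ ε) (hQ : IsCompact Q)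
    (hdom : DominatedBy f ft (relaxedSublevel f ft K c ε) Q) {x₀ : X}
    (hx₀ : x₀ ∈ feasibleSet ft) (hx₀c : f x₀ ≤ c) :
    ∃ z ∈ feasibleSet ft, IsMinOn f (feasibleSet ft) z := by
  have himprove : ∀ x ∈ feasibleSet ft, f x ≤ c → ∃ q ∈ Q ∩ feasibleSet ft, f q ≤ f x :=
    fun x hx hxc => by
      obtain ⟨q, hq, hqf, hqft⟩ := hdom x (mem_relaxedSublevel_of_mem_feasibleSet hx hxc K hε)
      exact ⟨q, ⟨hq, fun t => (hqft t).trans (hx t)⟩, hqf⟩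
  obtain ⟨q₀, hq₀, hq₀x₀⟩ := himprove x₀ hx₀ hx₀c
  obtain ⟨z, hz, hmin⟩ := (hf.lowerSemicontinuousOn _).exists_isMinOn ⟨q₀, hq₀⟩
    (hQ.inter_right (isClosed_feasibleSet hft))
  refine ⟨z, hz.2, isMinOn_iff.2 fun x hx => ?_⟩
  rcases le_total (f x) c with hxc | hcx
  · obtain ⟨q, hq, hqx⟩ := himprove x hx hxc
    exact (hmin hq).trans hqx
  · exact (hmin hq₀).trans (hq₀x₀.trans (hx₀c.trans hcx))

theorem exists_relaxedSublevel_eq_empty (hf : LowerSemicontinuous f)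
    (hft : ∀ t, LowerSemicontinuous (ft t)) (hε : 0 < ε) (hQ : IsCompact Q)
    (hdom : DominatedBy f ft (relaxedSublevel f ft K c ε) Q) {a : ℝ} (hac : a ≤ c)
    (ha : ∀ x ∈ feasibleSet ft, a < f x) :
    ∃ (J : Finset T) (η : ℝ), K ⊆ J ∧ 0 < η ∧ η ≤ ε ∧ relaxedSublevel f ft J a η = ∅ := by
  classical
  let V : Finset T × ℕ → Set X := fun j => relaxedSublevel f ft (K ∪ j.1) a (ε / (j.2 + 1))
  have hanti : Antitone V := fun i j hij =>
    relaxedSublevel_mono (Finset.union_subset_union_right hij.1) le_rfl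
      (div_le_div_of_nonneg_left hε.le (by positivity) (by exact_mod_cast Nat.succ_le_succ hij.2))
  have hempty : Q ∩ ⋂ j, V j = ∅ := by
    refine Set.eq_empty_of_forall_notMem fun x ⟨_, hx⟩ => ?_
    rw [Set.mem_iInter] at hx
    refine (ha x fun t => EReal.le_of_forall_lt_iff_le.1 fun η hη => ?_).not_ge (hx (∅, 0)).1
    obtain ⟨n, hn⟩ := exists_nat_one_div_lt (div_pos (EReal.coe_pos.1 hη) hε)
    have hnη : ε / (n + 1) ≤ η := by
      rw [lt_div_iff₀ hε, one_div_mul_eq_div] at hn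
      exact hn.le
    exact ((hx ({t}, n)).2 t (by simp)).trans (by exact_mod_cast hnη)
  obtain ⟨j, hj⟩ := hQ.elim_directed_family_closed V
    (fun _ => isClosed_relaxedSublevel hf hft _ _ _) hempty hanti.directed_ge
  have hη : ε / (j.2 + 1) ≤ ε := div_le_self hε.le (by simp)
  refine ⟨K ∪ j.1, ε / (j.2 + 1), Finset.subset_union_left, by positivity, hη,
    Set.eq_empty_of_forall_notMem fun x hx => ?_⟩
  obtain ⟨q, hq, hqf, hqft⟩ := hdom x (relaxedSublevel_mono Finset.subset_union_left hac hη hx)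
  exact Set.notMem_empty q (hj ▸ ⟨hq, hqf.trans hx.1, fun t ht => (hqft t).trans (hx.2 t ht)⟩)

theorem exists_real_le_of_isCompact {h : X → EReal} (hh : LowerSemicontinuous h)
    (hbot : ∀ x, h x ≠ ⊥) (hQ : IsCompact Q) : ∃ N : ℝ, ∀ q ∈ Q, (N : EReal) ≤ h q := by
  rcases Q.eq_empty_or_nonempty with rfl | hne
  · simp
  obtain ⟨z, -, hz⟩ := (hh.lowerSemicontinuousOn Q).exists_isMinOn hne hQ
  obtain ⟨N, -, hN⟩ := EReal.lt_iff_exists_real_btwn.1 (bot_lt_iff_ne_bot.2 (hbot z))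
  exact ⟨N, fun q hq => hN.le.trans (isMinOn_iff.1 hz q hq)⟩

end Compactness

theorem lagrangian_eq_of_support_subset {H : Finset T} (hH : lam.support ⊆ H) (x : X) :
    lagrangian f ft lam x = f x + ∑ t : H, ((lam t : ℝ) : EReal) * ft t x := by
  rw [lagrangian, Finset.sum_coe_sort H fun t => ((lam t : ℝ) : EReal) * ft t x,
    Finset.sum_subset hH fun t _ ht => by simp [Finsupp.notMem_support_iff.1 ht]]

theorem iInf_add_sum_le_supLagrangeDual (H : Finset T) (μ : H → ℝ≥0) :
    ⨅ x, (f x + ∑ t : H, ((μ t : ℝ) : EReal) * ft t x) ≤ supLagrangeDual f ft := by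
  classical
  let lam : T →₀ ℝ≥0 :=
    Finsupp.onFinset H (fun t => if ht : t ∈ H then μ ⟨t, ht⟩ else 0) fun t ht => by
      by_contra hnot
      simp [hnot] at ht
  refine le_iSup_of_le lam (iInf_mono fun x => ?_)
  rw [lagrangian_eq_of_support_subset Finsupp.support_onFinset_subset x]
  simp

theorem supLagrangeHaarDual_eq_supLagrangeDual [Nonempty T] :
    supLagrangeHaarDual f ft = supLagrangeDual f ft := by
  classical
  refine le_antisymm (iSup₂_le fun H _ => iSup_le fun μ => iInf_add_sum_le_supLagrangeDual H μ)
    (iSup_le fun lam => ?_)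
  let H := insert (Classical.arbitrary T) lam.support
  refine le_iSup₂_of_le H (Finset.insert_nonempty _ _) (le_iSup_of_le (fun t => lam t) ?_)
  exact iInf_mono fun x =>
    (lagrangian_eq_of_support_subset (Finset.subset_insert _ _) x).le

theorem supLagrangeDual_le_of_mem_feasibleSet {x : X} (hx : x ∈ feasibleSet ft) :
    supLagrangeDual f ft ≤ f x :=
  iSup_le fun _ => (iInf_le _ x).trans (lagrangian_le_of_mem_feasibleSet hx)

theorem supLagrangeDual_comp_equiv {Y : Type*} (e : Y ≃ X) :
    supLagrangeDual (f ∘ e) (fun t => ft t ∘ e) = supLagrangeDual f ft :=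
  iSup_congr fun lam => e.surjective.iInf_comp (lagrangian f ft lam)

theorem image_feasibleSet_comp_equiv {Y : Type*} (e : Y ≃ X) :
    (f ∘ e) '' feasibleSet (fun t => ft t ∘ e) = f '' feasibleSet ft := by
  rw [Set.image_comp]
  exact congrArg (f '' ·) (Set.image_preimage_eq (feasibleSet ft) e.surjective)

section StrongDuality

variable [AddCommGroup X] [Module ℝ X] [TopologicalSpace X] {K : Finset T} {c ε : ℝ} {Q : Set X}

theorem le_supLagrangeDual_of_forall_lt (hf : IsGamma f) (hft : ∀ t, IsGamma (ft t)) (hε : 0 < ε)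
    (hQ : IsCompact Q) (hdom : DominatedBy f ft (relaxedSublevel f ft K c ε) Q) {x₀ : X}
    (hx₀ : x₀ ∈ feasibleSet ft) (hx₀c : f x₀ < c) {α a : ℝ} (hα : α < a)
    (ha : ∀ x ∈ feasibleSet ft, a < f x) : (α : EReal) ≤ supLagrangeDual f ft := by
  have hac : a ≤ c := EReal.coe_le_coe_iff.1 ((ha x₀ hx₀).trans hx₀c).le
  obtain ⟨J, η, hKJ, hη, hηε, hempty⟩ := exists_relaxedSublevel_eq_empty hf.lowerSemicontinuous
    (fun t => (hft t).lowerSemicontinuous) hε hQ hdom hac ha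
  obtain ⟨N, hN⟩ := exists_real_le_of_isCompact hf.lowerSemicontinuous hf.ne_bot hQ
  choose M hM using fun t =>
    exists_real_le_of_isCompact (hft t).lowerSemicontinuous (hft t).ne_bot hQ
  obtain ⟨μ, hμ, hle⟩ := exists_pos_multipliers (g := fun t : J => ft t) (M := fun t => M t)
    hf.convex (fun t => (hft t).convex) hf.ne_bot (fun t => (hft t).ne_bot) hα hη.le hx₀c
    (fun t => (hx₀ t).trans_lt (by exact_mod_cast hη))
    (fun x hfx hgx => Set.notMem_empty x (hempty ▸ ⟨hfx, fun t ht => hgx ⟨t, ht⟩⟩))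
    (fun x hfx hgx => by
      obtain ⟨q, hq, hqf, hqft⟩ :=
        hdom x (relaxedSublevel_mono hKJ le_rfl hηε ⟨hfx, fun t ht => hgx ⟨t, ht⟩⟩)
      exact ⟨(hN q hq).trans hqf, fun t => (hM t q hq).trans (hqft t)⟩)
  exact (le_iInf hle).trans
    (iInf_add_sum_le_supLagrangeDual (ft := ft) J fun t => ⟨μ t, (hμ t).le⟩)

theorem exists_isLeast_and_supLagrangeDual_eq (hf : IsGamma f) (hft : ∀ t, IsGamma (ft t))
    (hε : 0 < ε) (hQ : IsCompact Q) (hdom : DominatedBy f ft (relaxedSublevel f ft K c ε) Q)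
    {x₀ : X} (hx₀ : x₀ ∈ feasibleSet ft) (hx₀c : f x₀ < c) :
    ∃ r : ℝ, IsLeast (f '' feasibleSet ft) r ∧ supLagrangeDual f ft = r := by
  obtain ⟨z, hz, hmin⟩ := exists_isMinOn_feasibleSet hf.lowerSemicontinuous
    (fun t => (hft t).lowerSemicontinuous) hε.le hQ hdom hx₀ hx₀c.le
  rw [isMinOn_iff] at hmin
  obtain ⟨r, hr⟩ : ∃ r : ℝ, f z = r :=
    ⟨(f z).toReal, (EReal.coe_toReal ((hmin x₀ hx₀).trans_lt (hx₀c.trans (EReal.coe_lt_top c))).ne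
      (hf.ne_bot z)).symm⟩
  refine ⟨r, ⟨⟨z, hz, hr⟩, Set.forall_mem_image.2 fun x hx => hr ▸ hmin x hx⟩,
    ((supLagrangeDual_le_of_mem_feasibleSet hz).trans_eq hr).antisymm ?_⟩
  refine EReal.ge_of_forall_gt_iff_ge.1 fun α hα => ?_
  obtain ⟨a, hαa, har⟩ := exists_between (EReal.coe_lt_coe_iff.1 hα)
  exact le_supLagrangeDual_of_forall_lt hf hft hε hQ hdom hx₀ hx₀c hαa fun x hx =>
    (by exact_mod_cast har : (a : EReal) < r).trans_le (hr ▸ hmin x hx)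

end StrongDuality

end Problem

theorem corollary6_general {X : Type*} [AddCommGroup X] [Module ℝ X] [TopologicalSpace X]
    [IsTopologicalAddGroup X] [ContinuousSMul ℝ X] [LocallyConvexSpace ℝ X]
    {T : Type*} [Nonempty T] (f : X → EReal) (ft : T → X → EReal)
    (hf : IsGamma f) (hft : ∀ t, IsGamma (ft t)) {lam : T →₀ ℝ≥0} {r : ℝ}
    (hr : ∃ x ∈ feasibleSet ft, f x < r)
    (hcomp : LocallyCompactSpace (toWeakSpace ℝ X '' {x | lagrangian f ft lam x ≤ r}))
    (hrec : ∃ L : Submodule ℝ X, (L : Set X) = problemRecCone f ft) :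
    ∃ r : ℝ, IsLeast (f '' feasibleSet ft) (r : EReal) ∧
      supLagrangeHaarDual f ft = (r : EReal) ∧
      supLagrangeDual f ft = (r : EReal) := by
  obtain ⟨x₀, hx₀, hx₀r⟩ := hr
  obtain ⟨L, hL⟩ := hrec
  obtain ⟨K, c, ε, Q, hc, hε, hQ, hdom⟩ :=
    exists_isCompact_dominatedBy (lam := lam) (r := r) hf hft hL hx₀ hx₀r
  let k := (toWeakSpace ℝ X).toEquiv
  obtain ⟨v, hv, hdual⟩ := exists_isLeast_and_supLagrangeDual_eq hf.comp_toWeakSpace_symm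
    (fun t => (hft t).comp_toWeakSpace_symm) hε hQ hdom (x₀ := k x₀) hx₀ hc
  simp only [supLagrangeHaarDual_eq_supLagrangeDual, and_self]
  exact ⟨v, image_feasibleSet_comp_equiv k.symm ▸ hv, supLagrangeDual_comp_equiv k.symm ▸ hdual⟩

theorem corollary6 {X : Type*} [AddCommGroup X] [Module ℝ X] [TopologicalSpace X]
    [IsTopologicalAddGroup X] [ContinuousSMul ℝ X] [LocallyConvexSpace ℝ X] [T2Space X]
    {T : Type*} [Nonempty T] (f : X → EReal) (ft : T → X → EReal)
    (hf : IsGamma f) (hft : ∀ t, IsGamma (ft t))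
    (hE : (feasibleSet ft ∩ effDom f).Nonempty)
    (hcomp : ∃ lam : T →₀ ℝ≥0, WeaklyInfLocallyCompact (lagrangian f ft lam))
    (hrec : ∃ L : Submodule ℝ X, (L : Set X) = problemRecCone f ft) :
    ∃ r : ℝ, IsLeast (f '' feasibleSet ft) (r : EReal) ∧
      supLagrangeHaarDual f ft = (r : EReal) ∧
      supLagrangeDual f ft = (r : EReal) := by
  obtain ⟨x₀, hx₀, hfx₀⟩ := hE
  obtain ⟨lam, hlam⟩ := hcomp
  obtain ⟨r, hr, -⟩ := EReal.lt_iff_exists_real_btwn.1 (show f x₀ < ⊤ from hfx₀)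
  exact corollary6_general f ft hf hft ⟨x₀, hx₀, hr⟩ (hlam r) hrec
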